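/- For integers $N\ge 2$ and $k\ge 1$, put $\zeta_N=e^{2\pi i/N}$ and define, for $\tau\in\mathbb{H}=\{\tau\in\mathbb{C}:\operatorname{Im}\tau>0\}$, the Eisenstein series $$G_{k,N}(\tau)=-\sum_{m=1}^{\infty}\Bigl(\sum_{d\mid m}\Bigl(\frac{m}{d}\Bigr)^{k-1}\frac{\zeta_N^{-d}+(-1)^k\zeta_N^{d}}{(k-1)!}\Bigr)e^{2\pi i m\tau}+\begin{cases}\dfrac{1+\zeta_N}{2(1-\zeta_N)} & \text{if } k=1,\\[2mm] \dfrac{B_k}{k!} & \text{if } k>1,\end{cases}$$ where $B_k$ is the $k$-th Bernoulli number, and put $G_{0,N}=1$. Proposition. Let $n\ge 1$ and $N\ge 2$ be integers with $N\mid n+1$, and let $k\ge n$. Then, for all $\tau\in\mathbb{H}$ (the argument $\tau$ is omitted), $$(-1)^{n+k+1}\sum_{\substack{0\le j_1,\dots,j_n\le k\\ j_1+\dots+j_n=k}}G_{j_1,N}\cdots G_{j_n,N}=\sum_{\ell=0}^{n-1}\binom{k-\ell-1}{n-\ell-1}\,G_{k-\ell,N}\sum_{\substack{0\le j_1,\dots,j_n\le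 \ell\\ j_1+\dots+j_n=\ell}}G_{j_1,N}\cdots G_{j_n,N}.$$ -/

import Mathlib

/-- The `m`-th Fourier coefficient (`m ≥ 1`), up to the sign `-1`, of the Eisenstein series of weight
`k ≥ 1` and level `N`:
`∑_{d ∣ m} (m / d)^(k-1) * (ζ^(-d) + (-1)^k ζ^d) / (k-1)!` with `ζ = exp (2πi / N)`. -/
noncomputable def eisensteinCoeff (k N m : ℕ) : ℂ :=
  ∑ d ∈ m.divisors, ((m : ℂ) / (d : ℂ)) ^ (k - 1) *
    ((Complex.exp (2 * Real.pi * Complex.I / N) ^ (-(d : ℤ)) +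
      (-1) ^ k * Complex.exp (2 * Real.pi * Complex.I / N) ^ (d : ℤ)) / ((k - 1).factorial : ℂ))

/-- The constant term of the Eisenstein series of weight `k ≥ 1` and level `N`. -/
noncomputable def eisensteinConst (k N : ℕ) : ℂ :=
  if k = 1 then
    (1 + Complex.exp (2 * Real.pi * Complex.I / N)) /
      (2 * (1 - Complex.exp (2 * Real.pi * Complex.I / N)))
  else ((bernoulli k : ℚ) : ℂ) / (k.factorial : ℂ)

/-- The Eisenstein series `G_{k,N}(τ)` for `k ≥ 1`, defined by its Fourier expansion at `∞`, with the
convention `G_{0,N} = 1`. -/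
noncomputable def eisensteinG (k N : ℕ) (τ : UpperHalfPlane) : ℂ :=
  if k = 0 then 1
  else -(∑' m : ℕ+, eisensteinCoeff k N m *
      Complex.exp (2 * Real.pi * Complex.I * ((m : ℕ) : ℂ) * (τ : ℂ))) + eisensteinConst k N

/-- The sum of all products `G_{j₁,N}(τ) ⋯ G_{jₙ,N}(τ)` over the tuples `(j₁, …, jₙ)` of natural
numbers with `j₁ + ⋯ + jₙ = s`. -/
noncomputable def eisensteinProdSum (n s N : ℕ) (τ : UpperHalfPlane) : ℂ :=
  ∑ j ∈ Finset.piAntidiag (Finset.univ : Finset (Fin n)) s, ∏ i, eisensteinG (j i) N τ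

theorem norm_eisensteinCoeff_le (k N m : ℕ) :
    ‖eisensteinCoeff k N m‖ ≤ 2 * ((m : ℝ) ^ (k - 1 + 1)) := by
  have hz : ‖Complex.exp (2 * Real.pi * Complex.I / N)‖ = 1 := by
    rw [show (2 * Real.pi * Complex.I / N : ℂ) = ((2 * Real.pi / N : ℝ) : ℂ) * Complex.I by
      push_cast; ring]
    exact Complex.norm_exp_ofReal_mul_I _
  have hterm : ∀ d ∈ m.divisors, ‖((m : ℂ) / (d : ℂ)) ^ (k - 1) *
      ((Complex.exp (2 * Real.pi * Complex.I / N) ^ (-(d : ℤ)) +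
      (-1) ^ k * Complex.exp (2 * Real.pi * Complex.I / N) ^ (d : ℤ)) /
        ((k - 1).factorial : ℂ))‖ ≤ (m : ℝ) ^ (k - 1) * 2 := by
    intro d hd
    have hd1 : (1 : ℝ) ≤ d := by exact_mod_cast Nat.pos_of_mem_divisors hd
    have hf : (1 : ℝ) ≤ ((k - 1).factorial : ℝ) := by exact_mod_cast Nat.factorial_pos _
    rw [norm_mul, norm_pow, norm_div, norm_div, Complex.norm_natCast, Complex.norm_natCast,
      Complex.norm_natCast]
    have h2 : ‖Complex.exp (2 * Real.pi * Complex.I / N) ^ (-(d : ℤ)) +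
      (-1) ^ k * Complex.exp (2 * Real.pi * Complex.I / N) ^ (d : ℤ)‖ ≤ 2 := by
      refine (norm_add_le _ _).trans ?_
      rw [norm_mul, norm_zpow, norm_zpow, hz]
      norm_num
    gcongr
    · exact div_le_self (by positivity) hd1
    · exact (div_le_self (norm_nonneg _) hf).trans h2
  refine (norm_sum_le _ _).trans ((Finset.sum_le_sum hterm).trans ?_)
  rw [Finset.sum_const, nsmul_eq_mul]
  have hc : (m.divisors.card : ℝ) ≤ m := by exact_mod_cast Nat.card_divisors_le_self m
  calc (m.divisors.card : ℝ) * ((m : ℝ) ^ (k - 1) * 2) ≤ m * ((m : ℝ) ^ (k - 1) * 2) := by gcongr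
    _ = _ := by ring

/-- The Fourier series in the definition of `eisensteinG` converges (absolutely) on the upper half
plane. -/
theorem summable_eisensteinG (k N : ℕ) (τ : UpperHalfPlane) :
    Summable fun m : ℕ+ => eisensteinCoeff k N m *
      Complex.exp (2 * Real.pi * Complex.I * ((m : ℕ) : ℂ) * (τ : ℂ)) := by
  have hq : ‖Complex.exp (2 * Real.pi * Complex.I * (τ : ℂ))‖ < 1 := by
    exact UpperHalfPlane.norm_exp_two_pi_I_lt_one τ
  have hs := (summable_norm_pow_mul_geometric_of_norm_lt_one (k - 1 + 1) hq).mul_left 2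
  have hs' : Summable fun m : ℕ => eisensteinCoeff k N m *
      Complex.exp (2 * Real.pi * Complex.I * (m : ℂ) * (τ : ℂ)) := by
    refine Summable.of_norm_bounded hs fun m => ?_
    rw [show (2 * Real.pi * Complex.I * (m : ℂ) * (τ : ℂ)) =
      m * (2 * Real.pi * Complex.I * (τ : ℂ)) by ring, Complex.exp_nat_mul, norm_mul, norm_mul,
      norm_pow (m : ℂ), Complex.norm_natCast, ← mul_assoc]
    gcongr
    exact norm_eisensteinCoeff_le k N m
  exact hs'.comp_injective PNat.coe_injective

/-!
Put `q = exp (2πiτ)` and `ζ = exp (2πi / N)`. The series `G₀, G₁, G₂, …` are the Laurent coefficients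
at the origin of the Kronecker function
`F(x) = 1 / (eˣ - 1) + 1 / (1 - ζ) - ∑_{a, d ≥ 1} qᵃᵈ (e^(ax) ζ⁻ᵈ - e^(-ax) ζᵈ) = ∑_{j ≥ 0} G_j xʲ⁻¹`
(`coeff_taylorSeriesAtZero_regKroneckerFun_eq_eisensteinG`). It has period `2πi` and satisfies
`F(x + 2πiτ) = ζ F(x)` (`kroneckerFun_add`), and its only poles are the simple ones at the lattice
points.

When `N ∣ n + 1`, the functions `F(x)ⁿ` and `F(-x)` have the same multiplier `ζ⁻¹`, hence so have
`F(x)ⁿ` and the derivatives of `F(-x)`. A linear combination of the derivatives of order less than `n`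
has the same principal part at the origin as `F(x)ⁿ`; the weights are the Laurent coefficients of
`Fⁿ`, which are the sums of products of Eisenstein series of total weight `l < n`. The difference of
the two sides (`kroneckerDefect`) is holomorphic and quasi-periodic with multiplier `ζ⁻¹ ≠ 1`, so it
vanishes by the maximum principle (`eventually_eq_zero_of_quasiPeriodic`). Comparing the coefficients
of `xᵏ⁻ⁿ` gives the identity.

The Lambert series converges only for `|Re x| < T`, where `‖q‖ = e^(-T)`. The translation `x ↦ x + 2πiτ`
moves the half `0 < Re x` of this strip onto the half `Re x < 0`, so there is no need to continue `F`
beyond the strip.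
-/

open Filter Topology

/-! ### Taylor series at the origin -/

/-- The Taylor series at `0` of a function, as a formal power series. It is multiplicative on
functions that are analytic at `0`. -/
noncomputable def taylorSeriesAtZero (f : ℂ → ℂ) : PowerSeries ℂ :=
  PowerSeries.mk fun s => iteratedDeriv s f 0 / (s.factorial : ℂ)

namespace taylorSeriesAtZero

theorem congr {f g : ℂ → ℂ} (h : f =ᶠ[𝓝 0] g) : taylorSeriesAtZero f = taylorSeriesAtZero g := by
  ext s
  simp [taylorSeriesAtZero, h.iteratedDeriv_eq s]

theorem mul {f g : ℂ → ℂ} (hf : AnalyticAt ℂ f 0) (hg : AnalyticAt ℂ g 0) :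
    taylorSeriesAtZero (fun x => f x * g x) = taylorSeriesAtZero f * taylorSeriesAtZero g := by
  ext s
  rw [PowerSeries.coeff_mul, Finset.Nat.sum_antidiagonal_eq_sum_range_succ_mk]
  simp only [taylorSeriesAtZero, PowerSeries.coeff_mk]
  rw [iteratedDeriv_fun_mul hf.contDiffAt hg.contDiffAt, Finset.sum_div]
  refine Finset.sum_congr rfl fun i hi => ?_
  have hi' : i ≤ s := Nat.lt_succ_iff.mp (Finset.mem_range.mp hi)
  have hs : (s.factorial : ℂ) ≠ 0 := by exact_mod_cast s.factorial_ne_zero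
  have hi0 : (i.factorial : ℂ) ≠ 0 := by exact_mod_cast i.factorial_ne_zero
  have hsi : ((s - i).factorial : ℂ) ≠ 0 := by exact_mod_cast (s - i).factorial_ne_zero
  have hc : (s.choose i : ℂ) * i.factorial * (s - i).factorial = s.factorial := by
    exact_mod_cast Nat.choose_mul_factorial_mul_factorial hi'
  field_simp
  rw [← hc]
  ring

theorem add {f g : ℂ → ℂ} (hf : AnalyticAt ℂ f 0) (hg : AnalyticAt ℂ g 0) :
    taylorSeriesAtZero (fun x => f x + g x) = taylorSeriesAtZero f + taylorSeriesAtZero g := by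
  ext s
  simp only [taylorSeriesAtZero, PowerSeries.coeff_mk, map_add]
  rw [iteratedDeriv_fun_add hf.contDiffAt hg.contDiffAt, add_div]

theorem sub {f g : ℂ → ℂ} (hf : AnalyticAt ℂ f 0) (hg : AnalyticAt ℂ g 0) :
    taylorSeriesAtZero (fun x => f x - g x) = taylorSeriesAtZero f - taylorSeriesAtZero g := by
  ext s
  simp only [taylorSeriesAtZero, PowerSeries.coeff_mk, map_sub]
  rw [iteratedDeriv_fun_sub hf.contDiffAt hg.contDiffAt, sub_div]

theorem const (c : ℂ) : taylorSeriesAtZero (fun _ => c) = PowerSeries.C c := by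
  ext s
  simp only [taylorSeriesAtZero, PowerSeries.coeff_mk, PowerSeries.coeff_C, iteratedDeriv_const]
  split_ifs with h <;> simp [h]

theorem pow_id (n : ℕ) : taylorSeriesAtZero (fun x => x ^ n) = PowerSeries.X ^ n := by
  ext s
  simp only [taylorSeriesAtZero, PowerSeries.coeff_mk, PowerSeries.coeff_X_pow,
    iteratedDeriv_fun_pow_zero]
  split_ifs with h
  · rw [h, div_self]
    exact_mod_cast n.factorial_ne_zero
  · simp

theorem id_mul {f : ℂ → ℂ} (hf : AnalyticAt ℂ f 0) :
    taylorSeriesAtZero (fun x => x * f x) = PowerSeries.X * taylorSeriesAtZero f := by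
  have h : taylorSeriesAtZero (fun x => x) = PowerSeries.X := by simpa using pow_id 1
  have hid : AnalyticAt ℂ (fun x : ℂ => x) 0 := analyticAt_id
  rw [mul hid hf, h]

theorem pow {f : ℂ → ℂ} (hf : AnalyticAt ℂ f 0) (n : ℕ) :
    taylorSeriesAtZero (fun x => f x ^ n) = taylorSeriesAtZero f ^ n := by
  induction n with
  | zero => simpa using const 1
  | succ n ih => simp only [pow_succ, mul (hf.fun_pow n) hf, ih]

theorem sum {ι : Type*} (s : Finset ι) {f : ι → ℂ → ℂ} (hf : ∀ i ∈ s, AnalyticAt ℂ (f i) 0) :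
    taylorSeriesAtZero (fun x => ∑ i ∈ s, f i x) = ∑ i ∈ s, taylorSeriesAtZero (f i) := by
  classical
  induction s using Finset.induction_on with
  | empty => simpa using const 0
  | insert i s hi ih =>
    have h1 := hf i (Finset.mem_insert_self i s)
    have h2 : ∀ j ∈ s, AnalyticAt ℂ (f j) 0 := fun j hj => hf j (Finset.mem_insert_of_mem hj)
    simp only [Finset.sum_insert hi]
    rw [add h1 (Finset.analyticAt_fun_sum s h2), ih h2]

theorem exp : taylorSeriesAtZero Complex.exp = PowerSeries.exp ℂ := by
  ext s
  simp [taylorSeriesAtZero, PowerSeries.coeff_exp, iteratedDeriv_eq_iterate]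

/-- The Taylor series of `f⁽ʳ⁾(-x)`. -/
theorem coeff_iteratedDeriv_comp_neg (f : ℂ → ℂ) (r s : ℕ) :
    PowerSeries.coeff s (taylorSeriesAtZero fun x => iteratedDeriv r f (-x)) =
      (-1) ^ s * r.factorial * ((s + r).choose r : ℂ) *
        PowerSeries.coeff (s + r) (taylorSeriesAtZero f) := by
  simp only [taylorSeriesAtZero, PowerSeries.coeff_mk]
  rw [iteratedDeriv_comp_neg, neg_zero]
  have h1 : iteratedDeriv s (iteratedDeriv r f) 0 = iteratedDeriv (s + r) f 0 := by
    simp only [iteratedDeriv_eq_iterate, Function.iterate_add_apply]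
  rw [h1]
  have hs : (s.factorial : ℂ) ≠ 0 := by exact_mod_cast s.factorial_ne_zero
  have hsr : ((s + r).factorial : ℂ) ≠ 0 := by exact_mod_cast (s + r).factorial_ne_zero
  have hc : ((s + r).choose r : ℂ) * s.factorial * r.factorial = (s + r).factorial := by
    exact_mod_cast Nat.add_choose_mul_factorial_mul_factorial s r
  field_simp
  rw [← hc, smul_eq_mul]
  ring

/-- If the first `n` Taylor coefficients vanish, then `f` is divisible by `x ^ n`. -/
theorem exists_eq_pow_mul {f : ℂ → ℂ} (hf : AnalyticAt ℂ f 0) {n : ℕ}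
    (h : ∀ s < n, PowerSeries.coeff s (taylorSeriesAtZero f) = 0) :
    ∃ g : ℂ → ℂ, AnalyticAt ℂ g 0 ∧ ∀ᶠ x in 𝓝 0, f x = x ^ n * g x := by
  have h0 : ∀ i < n, iteratedDeriv i f 0 = 0 := fun i hi => by
    have hi0 : (i.factorial : ℂ) ≠ 0 := by exact_mod_cast i.factorial_ne_zero
    simpa [taylorSeriesAtZero, hi0] using h i hi
  obtain ⟨g, hg, hfg⟩ := (natCast_le_analyticOrderAt hf).mp
    ((natCast_le_analyticOrderAt_iff_iteratedDeriv_eq_zero hf).mpr h0)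
  exact ⟨g, hg, by simpa using hfg⟩

end taylorSeriesAtZero

/-! ### A Liouville theorem on a vertical strip -/

/-- The function whose value at `x` is the limit of `D` at `x` along punctured neighbourhoods. It fills
in removable singularities; where the limit does not exist its value is meaningless. -/
noncomputable def limExtension (D : ℂ → ℂ) (x : ℂ) : ℂ := limUnder (𝓝[≠] x) D

theorem limExtension_eventuallyEq {D f : ℂ → ℂ} {x : ℂ} (hf : AnalyticAt ℂ f x)
    (h : D =ᶠ[𝓝[≠] x] f) : limExtension D =ᶠ[𝓝 x] f := by
  have key : ∀ y, ContinuousAt f y → D =ᶠ[𝓝[≠] y] f → limExtension D y = f y := fun y hy hD =>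
    Tendsto.limUnder_eq
      ((hy.tendsto.mono_left nhdsWithin_le_nhds).congr' hD.symm)
  have h1 : ∀ᶠ y in 𝓝[≠] x, D =ᶠ[𝓝[≠] y] f := by
    filter_upwards [eventually_eventually_nhdsWithin.mpr h, self_mem_nhdsWithin] with y hy hyx
    rw [isOpen_compl_singleton.nhdsWithin_eq hyx] at hy
    exact hy.filter_mono nhdsWithin_le_nhds
  have h2 : ∀ᶠ y in 𝓝 x, D =ᶠ[𝓝[≠] y] f := by
    rw [eventually_nhdsWithin_iff] at h1
    filter_upwards [h1] with y hy
    rcases eq_or_ne y x with rfl | hyx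
    · exact h
    · exact hy hyx
  filter_upwards [h2, hf.eventually_continuousAt] with y hy hc using key y hc hy

theorem limExtension_add_of_eventually {D f : ℂ → ℂ} {x ω c : ℂ} (hf : AnalyticAt ℂ f x)
    (h : D =ᶠ[𝓝[≠] x] f) (hω : ∀ᶠ y in 𝓝 x, D (y + ω) = c * D y) :
    limExtension D (x + ω) = c * limExtension D x := by
  have hx := (limExtension_eventuallyEq hf h).eq_of_nhds
  have hlim : Tendsto D (𝓝[≠] (x + ω)) (𝓝 (c * f x)) := by
    have ht : Tendsto (fun y => y - ω) (𝓝[≠] (x + ω)) (𝓝[≠] x) := by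
      refine tendsto_nhdsWithin_iff.mpr ⟨?_, ?_⟩
      · have : Tendsto (fun y => y - ω) (𝓝 (x + ω)) (𝓝 (x + ω - ω)) :=
          (continuous_id.sub continuous_const).tendsto _
        rw [add_sub_cancel_right] at this
        exact this.mono_left nhdsWithin_le_nhds
      · filter_upwards [self_mem_nhdsWithin] with y hy h'
        exact hy (by rw [Set.mem_singleton_iff] at h' ⊢; rw [← h', sub_add_cancel])
    have h1 : Tendsto (fun y => c * f y) (𝓝[≠] x) (𝓝 (c * f x)) :=
      (hf.continuousAt.tendsto.const_mul c).mono_left nhdsWithin_le_nhds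
    have h2 : (fun y => c * f y) =ᶠ[𝓝[≠] x] fun y => D (y + ω) := by
      filter_upwards [h, hω.filter_mono nhdsWithin_le_nhds] with y hy hy'
      rw [hy', hy]
    have := (h1.congr' h2).comp ht
    refine this.congr fun y => ?_
    simp
  rw [hx]
  exact hlim.limUnder_eq

theorem isOpen_abs_re_lt (T : ℝ) : IsOpen {x : ℂ | |x.re| < T} :=
  isOpen_lt (continuous_abs.comp Complex.continuous_re) continuous_const

theorem convex_abs_re_lt (T : ℝ) : Convex ℝ {x : ℂ | |x.re| < T} := by
  have : {x : ℂ | |x.re| < T} = Complex.reLm ⁻¹' Set.Ioo (-T) T := by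
    ext x; simp [abs_lt]
  rw [this]
  exact (convex_Ioo _ _).linear_preimage _

/-- A doubly quasi-periodic function on the strip `|Re x| < T`, all of whose singularities are
removable, vanishes if its multiplier `c` is a number of absolute value one other than `1`. -/
theorem eventually_eq_zero_of_quasiPeriodic {D : ℂ → ℂ} {T : ℝ} {ω c : ℂ} (hT : 0 < T)
    (hω : ω.re = -T) (hc : ‖c‖ = 1) (hc1 : c ≠ 1)
    (hreg : ∀ x : ℂ, |x.re| < T → ∃ f, AnalyticAt ℂ f x ∧ D =ᶠ[𝓝[≠] x] f)
    (hper : ∀ x, D (x + 2 * Real.pi * Complex.I) = D x)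
    (hquasi : ∀ x : ℂ, 0 < x.re → x.re < T → D (x + ω) = c * D x) {x : ℂ} (hx : |x.re| < T) :
    ∀ᶠ y in 𝓝[≠] x, D y = 0 := by
  set S : Set ℂ := {x : ℂ | |x.re| < T} with hS
  set E := limExtension D with hE
  have hSo : IsOpen S := isOpen_abs_re_lt T
  have hEan : ∀ x ∈ S, AnalyticAt ℂ E x := fun x hx => by
    obtain ⟨f, hf, hDf⟩ := hreg x hx
    exact hf.congr (limExtension_eventuallyEq hf hDf).symm
  have hEper : Function.Periodic (fun x : ℂ => E x) (2 * Real.pi * Complex.I) := fun x => by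
    have : (fun y => D (y + 2 * Real.pi * Complex.I)) = D := funext hper
    simp only [hE, limExtension, limUnder]
    congr 1
    conv_rhs => rw [← this]
    rw [show (fun y => D (y + 2 * Real.pi * Complex.I)) =
      D ∘ (Homeomorph.addRight (2 * Real.pi * Complex.I : ℂ)) from rfl, ← Filter.map_map]
    congr 1
    rw [(Homeomorph.addRight (2 * Real.pi * Complex.I : ℂ)).isEmbedding.map_nhdsWithin_eq]
    congr 1
    simp
  have hEquasi : ∀ x : ℂ, 0 < x.re → x.re < T → E (x + ω) = c * E x := fun x h0 h1 => by
    obtain ⟨f, hf, hDf⟩ := hreg x (by rw [abs_of_pos h0]; exact h1)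
    refine limExtension_add_of_eventually hf hDf ?_
    filter_upwards [(isOpen_lt continuous_const Complex.continuous_re).mem_nhds h0,
      (isOpen_lt Complex.continuous_re continuous_const).mem_nhds h1] with y hy0 hy1
    exact hquasi y hy0 hy1
  -- Every point of the strip can be moved into the compact rectangle `K` by the two translations,
  -- which do not change `‖E‖`. So the maximum of `‖E‖` over `K` is a maximum over the whole strip.
  set K : Set ℂ := Set.Icc (-(T / 2)) (T / 2) ×ℂ Set.Icc 0 (2 * Real.pi) with hK
  have hKc : IsCompact K := isCompact_Icc.reProdIm isCompact_Icc
  have hKS : K ⊆ S := fun y hy => by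
    have := (Complex.mem_reProdIm.mp hy).1
    rw [hS, Set.mem_ofPred_eq, abs_lt]
    constructor <;> linarith [this.1, this.2]
  have hKne : K.Nonempty := ⟨0, by
    rw [hK, Complex.mem_reProdIm]
    simp only [Complex.zero_re, Complex.zero_im, Set.mem_Icc]
    exact ⟨⟨by linarith, by linarith⟩, le_rfl, by positivity⟩⟩
  obtain ⟨m, hmK, hm⟩ := hKc.exists_isMaxOn hKne
    (f := fun y => ‖E y‖) fun y hy => (hEan y (hKS hy)).continuousAt.norm.continuousWithinAt
  have hhalf : ∀ y : ℂ, |y.re| ≤ T / 2 → ‖E y‖ ≤ ‖E m‖ := fun y hy => by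
    obtain ⟨k, hk, -⟩ := existsUnique_add_zsmul_mem_Ico
      (show (0 : ℝ) < 2 * Real.pi by positivity) y.im 0
    have hp : E (y + k • (2 * Real.pi * Complex.I)) = E y := hEper.zsmul k y
    rw [← hp]
    refine hm (Complex.mem_reProdIm.mpr ⟨?_, ?_⟩)
    · simpa using abs_le.mp hy
    · have h2 : (y + k • (2 * Real.pi * Complex.I)).im = y.im + k • (2 * Real.pi) := by simp
      rw [h2]
      exact ⟨hk.1, by simpa using hk.2.le⟩
  have hmax : IsMaxOn (norm ∘ E) S m := fun y hy => by
    have hy' := abs_lt.mp (show |y.re| < T from hy)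
    rw [Set.mem_ofPred_eq, Function.comp, Function.comp]
    by_cases h1 : |y.re| ≤ T / 2
    · exact hhalf y h1
    · rcases lt_abs.mp (not_le.mp h1) with h | h
      · have h3 := hEquasi y (by linarith) hy'.2
        have : ‖E (y + ω)‖ = ‖E y‖ := by rw [h3, norm_mul, hc, one_mul]
        rw [← this]
        apply hhalf
        rw [Complex.add_re, hω, abs_le]
        constructor <;> linarith
      · have h3 := hEquasi (y - ω) (by rw [Complex.sub_re, hω]; linarith)
          (by rw [Complex.sub_re, hω]; linarith)
        rw [sub_add_cancel] at h3
        have : ‖E y‖ = ‖E (y - ω)‖ := by rw [h3, norm_mul, hc, one_mul]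
        rw [this]
        apply hhalf
        rw [Complex.sub_re, hω, abs_le]
        constructor <;> linarith
  have hconst := Complex.eqOn_of_isPreconnected_of_isMaxOn_norm (convex_abs_re_lt T).isPreconnected
    hSo (fun y hy => (hEan y hy).differentiableAt.differentiableWithinAt) (hKS hmK) hmax
  have hre : ((T / 2 : ℝ) : ℂ).re = T / 2 := Complex.ofReal_re _
  -- The constant value is invariant under multiplication by `c ≠ 1`.
  have hEm : E m = 0 := by
    have h1 : E ((T / 2 : ℝ) : ℂ) = E m := hconst (show |_| < T by
      rw [hre, abs_of_pos (by linarith)]; linarith)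
    have h2 : E (((T / 2 : ℝ) : ℂ) + ω) = E m := hconst (show |_| < T by
      rw [Complex.add_re, hre, hω, abs_lt]; constructor <;> linarith)
    have h3 := hEquasi ((T / 2 : ℝ) : ℂ) (by rw [hre]; linarith) (by rw [hre]; linarith)
    rw [h1, h2] at h3
    have h4 : (c - 1) * E m = 0 := by rw [sub_mul, one_mul, ← h3, sub_self]
    exact (mul_eq_zero.mp h4).resolve_left (sub_ne_zero.mpr hc1)
  obtain ⟨f, hf, hDf⟩ := hreg x hx
  filter_upwards [hDf, (limExtension_eventuallyEq hf hDf).filter_mono nhdsWithin_le_nhds,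
    mem_nhdsWithin_of_mem_nhds (hSo.mem_nhds hx)] with y h1 h2 h3
  rw [h1, ← h2, ← hE, hconst h3]
  exact hEm

/-! ### The Lambert series of the Kronecker function -/

/-- The `a`-th term of the `j`-th derivative of the Lambert series
`∑_{a ≥ 1} (e^(ax) qᵃζ⁻¹ / (1 - qᵃζ⁻¹) - e^(-ax) qᵃζ / (1 - qᵃζ))`. -/
noncomputable def lambertTerm (q ζ : ℂ) (j : ℕ) (a : ℕ+) (x : ℂ) : ℂ :=
  (a : ℂ) ^ j * (Complex.exp (a * x) * (q ^ (a : ℕ) * ζ⁻¹ / (1 - q ^ (a : ℕ) * ζ⁻¹)) -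
    (-1) ^ j * (Complex.exp (-(a * x)) * (q ^ (a : ℕ) * ζ / (1 - q ^ (a : ℕ) * ζ))))

/-- The `j`-th derivative of the Lambert series
`∑_{a ≥ 1} (e^(ax) qᵃζ⁻¹ / (1 - qᵃζ⁻¹) - e^(-ax) qᵃζ / (1 - qᵃζ))`. -/
noncomputable def lambertSum (q ζ : ℂ) (j : ℕ) (x : ℂ) : ℂ :=
  ∑' a : ℕ+, lambertTerm q ζ j a x

theorem one_sub_pow_mul_ne_zero {q z : ℂ} (hq : ‖q‖ < 1) (hz : ‖z‖ = 1) (a : ℕ+) :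
    1 - q ^ (a : ℕ) * z ≠ 0 := by
  intro h
  have h1 : ‖q ^ (a : ℕ) * z‖ < 1 := by
    rw [norm_mul, hz, mul_one, norm_pow]
    exact pow_lt_one₀ (norm_nonneg q) hq a.ne_zero
  rw [← sub_eq_zero.mp h, norm_one] at h1
  exact lt_irrefl _ h1

theorem norm_pow_mul_div_one_sub_le {q z : ℂ} (hq : ‖q‖ < 1) (hz : ‖z‖ = 1) (a : ℕ+) :
    ‖q ^ (a : ℕ) * z / (1 - q ^ (a : ℕ) * z)‖ ≤ ‖q‖ ^ (a : ℕ) / (1 - ‖q‖) := by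
  have h1 : ‖q ^ (a : ℕ) * z‖ = ‖q‖ ^ (a : ℕ) := by rw [norm_mul, hz, mul_one, norm_pow]
  have h2 : ‖q‖ ^ (a : ℕ) ≤ ‖q‖ := pow_le_of_le_one (norm_nonneg q) hq.le a.ne_zero
  have h3 : 1 - ‖q‖ ≤ ‖1 - q ^ (a : ℕ) * z‖ := by
    have := norm_sub_norm_le (1 : ℂ) (q ^ (a : ℕ) * z)
    rw [norm_one, h1] at this
    linarith
  rw [norm_div, h1]
  have : 0 < 1 - ‖q‖ := by linarith
  gcongr

theorem norm_lambertTerm_le {q ζ : ℂ} (hq : ‖q‖ < 1) (hζ : ‖ζ‖ = 1) {R : ℝ} (j : ℕ) (a : ℕ+)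
    {x : ℂ} (hx : |x.re| ≤ R) :
    ‖lambertTerm q ζ j a x‖ ≤
      2 / (1 - ‖q‖) * ((a : ℝ) ^ j * (‖q‖ * Real.exp R) ^ (a : ℕ)) := by
  have hζ' : ‖ζ⁻¹‖ = 1 := by rw [norm_inv, hζ, inv_one]
  have hq1 : 0 < 1 - ‖q‖ := by linarith
  have hx' := abs_le.mp hx
  have ha : (0 : ℝ) ≤ ((a : ℕ) : ℝ) := Nat.cast_nonneg _
  have h1 : ‖Complex.exp (a * x)‖ ≤ Real.exp R ^ (a : ℕ) := by
    rw [← Real.exp_nat_mul, Complex.norm_exp]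
    simp only [Complex.mul_re, Complex.natCast_re, Complex.natCast_im, zero_mul, sub_zero]
    gcongr
    exact hx'.2
  have h2 : ‖Complex.exp (-(a * x))‖ ≤ Real.exp R ^ (a : ℕ) := by
    rw [← Real.exp_nat_mul, Complex.norm_exp, ← mul_neg]
    simp only [Complex.mul_re, Complex.natCast_re, Complex.natCast_im, zero_mul, sub_zero,
      Complex.neg_re]
    gcongr
    linarith
  have hu := norm_pow_mul_div_one_sub_le hq hζ' a
  have hv := norm_pow_mul_div_one_sub_le hq hζ a
  rw [lambertTerm, norm_mul, norm_pow, Complex.norm_natCast]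
  calc (a : ℝ) ^ j * _ ≤ (a : ℝ) ^ j * (Real.exp R ^ (a : ℕ) * (‖q‖ ^ (a : ℕ) / (1 - ‖q‖)) +
        Real.exp R ^ (a : ℕ) * (‖q‖ ^ (a : ℕ) / (1 - ‖q‖))) := by
        gcongr
        refine (norm_sub_le _ _).trans ?_
        rw [norm_mul ((-1) ^ j), norm_pow, norm_neg, norm_one, one_pow, one_mul, norm_mul, norm_mul]
        gcongr
    _ = _ := by rw [mul_pow]; field_simp; ring

theorem norm_mul_exp_lt_one {q : ℂ} {R T : ℝ} (hT : ‖q‖ = Real.exp (-T)) (hR : R < T) :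
    ‖q‖ * Real.exp R < 1 := by
  rw [hT, ← Real.exp_add, Real.exp_lt_one_iff]
  linarith

theorem summable_lambertBound {q : ℂ} {R T : ℝ} (hT : ‖q‖ = Real.exp (-T)) (hR : R < T) (j : ℕ) :
    Summable fun a : ℕ+ => 2 / (1 - ‖q‖) * ((a : ℝ) ^ j * (‖q‖ * Real.exp R) ^ (a : ℕ)) := by
  have h : ‖‖q‖ * Real.exp R‖ < 1 := by
    rw [Real.norm_of_nonneg (by positivity)]
    exact norm_mul_exp_lt_one hT hR
  exact ((summable_pow_mul_geometric_of_norm_lt_one j h).comp_injective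
    PNat.coe_injective).mul_left _

theorem summable_lambertTerm {q ζ : ℂ} {T : ℝ} (hT : ‖q‖ = Real.exp (-T)) (hq : ‖q‖ < 1)
    (hζ : ‖ζ‖ = 1) (j : ℕ) {x : ℂ} (hx : |x.re| < T) :
    Summable fun a : ℕ+ => lambertTerm q ζ j a x :=
  Summable.of_norm_bounded (summable_lambertBound hT hx j)
    fun a => norm_lambertTerm_le hq hζ j a le_rfl

theorem hasDerivAt_lambertTerm (q ζ : ℂ) (j : ℕ) (a : ℕ+) (x : ℂ) :
    HasDerivAt (lambertTerm q ζ j a) (lambertTerm q ζ (j + 1) a x) x := by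
  have h0 : HasDerivAt (fun y : ℂ => (a : ℂ) * y) a x := by
    simpa using (hasDerivAt_id x).const_mul (a : ℂ)
  have h1 := (h0.cexp.mul_const (q ^ (a : ℕ) * ζ⁻¹ / (1 - q ^ (a : ℕ) * ζ⁻¹))).sub
    ((h0.fun_neg.cexp.mul_const (q ^ (a : ℕ) * ζ / (1 - q ^ (a : ℕ) * ζ))).const_mul ((-1) ^ j))
  refine (h1.const_mul ((a : ℂ) ^ j)).congr_deriv ?_
  rw [lambertTerm]
  ring

theorem hasDerivAt_lambertSum {q ζ : ℂ} {T : ℝ} (hT : ‖q‖ = Real.exp (-T)) (hq : ‖q‖ < 1)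
    (hζ : ‖ζ‖ = 1) (j : ℕ) {x : ℂ} (hx : |x.re| < T) :
    HasDerivAt (lambertSum q ζ j) (lambertSum q ζ (j + 1) x) x := by
  obtain ⟨R, hxR, hRT⟩ := exists_between hx
  exact hasDerivAt_tsum_of_isPreconnected (summable_lambertBound hT hRT (j + 1))
    (isOpen_abs_re_lt R) (convex_abs_re_lt R).isPreconnected
    (fun a y _ => hasDerivAt_lambertTerm q ζ j a y)
    (fun a y hy => norm_lambertTerm_le hq hζ (j + 1) a (le_of_lt hy)) hxR
    (summable_lambertTerm hT hq hζ j hx) hxR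

theorem analyticAt_lambertSum {q ζ : ℂ} {T : ℝ} (hT : ‖q‖ = Real.exp (-T)) (hq : ‖q‖ < 1)
    (hζ : ‖ζ‖ = 1) (j : ℕ) {x : ℂ} (hx : |x.re| < T) : AnalyticAt ℂ (lambertSum q ζ j) x :=
  DifferentiableOn.analyticAt (s := {x : ℂ | |x.re| < T})
    (fun _ hy => (hasDerivAt_lambertSum hT hq hζ j hy).differentiableAt.differentiableWithinAt)
    ((isOpen_abs_re_lt T).mem_nhds hx)

theorem iteratedDeriv_lambertSum {q ζ : ℂ} {T : ℝ} (hT : ‖q‖ = Real.exp (-T)) (hq : ‖q‖ < 1)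
    (hζ : ‖ζ‖ = 1) (j : ℕ) {x : ℂ} (hx : |x.re| < T) :
    iteratedDeriv j (lambertSum q ζ 0) x = lambertSum q ζ j x := by
  induction j generalizing x with
  | zero => simp
  | succ j ih =>
    have h : iteratedDeriv j (lambertSum q ζ 0) =ᶠ[𝓝 x] lambertSum q ζ j := by
      filter_upwards [(isOpen_abs_re_lt T).mem_nhds hx] with y hy using ih hy
    rw [iteratedDeriv_succ, h.deriv_eq, (hasDerivAt_lambertSum hT hq hζ j hx).deriv]

theorem hasSum_geometric_pnat {r : ℂ} (hr : ‖r‖ < 1) :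
    HasSum (fun a : ℕ+ => r ^ (a : ℕ)) (r / (1 - r)) := by
  rw [← Equiv.pnatEquivNat.symm.hasSum_iff]
  have h := (hasSum_geometric_of_norm_lt_one hr).mul_left r
  rw [← div_eq_mul_inv] at h
  refine h.congr_fun fun n => ?_
  simp [pow_succ']

/-- The value at `0` of the `j`-th derivative of the Lambert series, as a power series in `q`. -/
theorem lambertSum_zero_eq {q ζ : ℂ} (hq : ‖q‖ < 1) (hζ : ‖ζ‖ = 1) (j : ℕ) :
    lambertSum q ζ j 0 = ∑' m : ℕ+, (∑ d ∈ (m : ℕ).divisors, (((m : ℕ) : ℂ) / (d : ℂ)) ^ j *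
      (ζ ^ (-(d : ℤ)) + (-1) ^ (j + 1) * ζ ^ (d : ℤ))) * q ^ (m : ℕ) := by
  set c : ℕ → ℕ → ℂ := fun d a => (a : ℂ) ^ j *
    (ζ ^ (-(d : ℤ)) + (-1) ^ (j + 1) * ζ ^ (d : ℤ)) * q ^ (d * a) with hc
  have hζ' : ‖ζ⁻¹‖ = 1 := by rw [norm_inv, hζ, inv_one]
  have hsum : Summable fun p : ℕ+ × ℕ+ => c p.1 p.2 := by
    refine Summable.of_norm_bounded ((summable_prod_mul_pow j hq).norm.mul_left 2) fun p => ?_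
    rw [hc]
    simp only [norm_mul, norm_pow]
    have : ‖ζ ^ (-((p.1 : ℕ) : ℤ)) + (-1) ^ (j + 1) * ζ ^ ((p.1 : ℕ) : ℤ)‖ ≤ 2 := by
      refine (norm_add_le _ _).trans ?_
      rw [norm_mul, norm_zpow, norm_zpow, hζ]
      norm_num
    calc _ ≤ ‖((p.2 : ℕ) : ℂ)‖ ^ j * 2 * ‖q‖ ^ ((p.1 : ℕ) * p.2) := by gcongr
      _ = _ := by ring
  have hrow : ∀ a : ℕ+, HasSum (fun d : ℕ+ => c d a) (lambertTerm q ζ j a 0) := fun a => by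
    have hlt : ∀ z : ℂ, ‖z‖ = 1 → ‖q ^ (a : ℕ) * z‖ < 1 := fun z hz => by
      rw [norm_mul, hz, mul_one, norm_pow]
      exact pow_lt_one₀ (norm_nonneg q) hq a.ne_zero
    have h := ((hasSum_geometric_pnat (hlt _ hζ')).sub
      ((hasSum_geometric_pnat (hlt _ hζ)).mul_left ((-1) ^ j))).mul_left ((a : ℂ) ^ j)
    rw [lambertTerm]
    simp only [mul_zero, neg_zero, Complex.exp_zero, one_mul]
    refine h.congr_fun fun d => ?_
    rw [hc]
    simp only [zpow_neg, zpow_natCast, mul_pow, inv_pow, pow_mul, pow_succ]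
    rw [← pow_mul, mul_comm (d : ℕ), pow_mul]
    ring
  -- Each term is a geometric series in `d`; collect the double series according to `m = d * a`.
  calc lambertSum q ζ j 0 = ∑' a : ℕ+, ∑' d : ℕ+, c d a :=
        tsum_congr fun a => (hrow a).tsum_eq.symm
    _ = ∑' p : ℕ+ × ℕ+, c p.1 p.2 := by
        rw [← (Equiv.prodComm ℕ+ ℕ+).tsum_eq]
        exact (((Equiv.prodComm ℕ+ ℕ+).summable_iff.mpr hsum).tsum_prod).symm
    _ = _ := by
        rw [← sigmaAntidiagonalEquivProd.tsum_eq]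
        refine (Summable.tsum_sigma (sigmaAntidiagonalEquivProd.summable_iff.mpr hsum)).trans ?_
        refine tsum_congr fun m => ?_
        rw [tsum_fintype]
        refine ((m : ℕ).divisorsAntidiagonal.sum_attach fun p => c p.1 p.2).trans ?_
        rw [Nat.sum_divisorsAntidiagonal c, Finset.sum_mul]
        refine Finset.sum_congr rfl fun d hd => ?_
        have hdm := Nat.dvd_of_mem_divisors hd
        have hd0 : (d : ℂ) ≠ 0 := by exact_mod_cast (Nat.pos_of_mem_divisors hd).ne'
        rw [hc]
        simp only
        rw [Nat.mul_div_cancel' hdm, Nat.cast_div hdm hd0]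

/-! ### The Kronecker function -/

/-- The Kronecker function
`1 / (eˣ - 1) + 1 / (1 - ζ) - ∑_{a, d ≥ 1} qᵃᵈ (e^(ax) ζ⁻ᵈ - e^(-ax) ζᵈ)`, meaningful on the strip
`|Re x| < -log ‖q‖` away from its poles, the points of `2πiℤ`. The inner sum over `d` is written in
closed form. -/
noncomputable def kroneckerFun (q ζ x : ℂ) : ℂ :=
  1 / (Complex.exp x - 1) + 1 / (1 - ζ) - lambertSum q ζ 0 x

theorem kroneckerFun_add_two_pi_mul_I (q ζ x : ℂ) :
    kroneckerFun q ζ (x + 2 * Real.pi * Complex.I) = kroneckerFun q ζ x := by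
  have h : ∀ a : ℕ, Complex.exp (a * (x + 2 * Real.pi * Complex.I)) = Complex.exp (a * x) :=
    fun a => by rw [Complex.exp_nat_mul, Complex.exp_nat_mul, Complex.exp_periodic]
  simp only [kroneckerFun, lambertSum, lambertTerm, Complex.exp_neg, h]
  rw [Complex.exp_periodic]

/-- The Kronecker function is quasi-periodic with multiplier `ζ`. With `w = eˣ`, both sides are
expansions of `∑_{m ∈ ℤ} ζ w⁻ᵐ / (1 - qᵐ ζ)`, valid for `1 < ‖w‖ < ‖q‖⁻¹`. -/
theorem kroneckerFun_add {q ζ ω : ℂ} {T : ℝ} (hT : ‖q‖ = Real.exp (-T)) (hq : ‖q‖ < 1)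
    (hζ : ‖ζ‖ = 1) (hζ1 : ζ ≠ 1) (hω : Complex.exp ω = q) {x : ℂ} (h0 : 0 < x.re)
    (h1 : x.re < T) : kroneckerFun q ζ (x + ω) = ζ * kroneckerFun q ζ x := by
  have hζ' : ‖ζ⁻¹‖ = 1 := by rw [norm_inv, hζ, inv_one]
  have hζ0 : ζ ≠ 0 := norm_ne_zero_iff.mp (by rw [hζ]; exact one_ne_zero)
  have hωre : ω.re = -T := by
    rw [← hω, Complex.norm_exp, Real.exp_eq_exp] at hT
    exact hT
  set w := Complex.exp x with hw
  have hw0 : w ≠ 0 := Complex.exp_ne_zero x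
  have hq0 : q ≠ 0 := hω ▸ Complex.exp_ne_zero ω
  have hwn : 1 < ‖w‖ := by rw [hw, Complex.norm_exp]; exact Real.one_lt_exp_iff.mpr h0
  have hw1 : ‖w⁻¹‖ < 1 := by rw [norm_inv]; exact inv_lt_one_of_one_lt₀ hwn
  have hqw : ‖q * w‖ < 1 := by
    rw [norm_mul, hw, Complex.norm_exp]
    exact norm_mul_exp_lt_one hT h1
  have hterm : ∀ a : ℕ+, lambertTerm q ζ 0 a (x + ω) - ζ * lambertTerm q ζ 0 a x =
      -(q * w) ^ (a : ℕ) - ζ * w⁻¹ ^ (a : ℕ) := fun a => by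
    have hu := one_sub_pow_mul_ne_zero hq hζ' a
    have hv := one_sub_pow_mul_ne_zero hq hζ a
    have hqa : q ^ (a : ℕ) ≠ 0 := pow_ne_zero _ hq0
    have hwa : w ^ (a : ℕ) ≠ 0 := pow_ne_zero _ hw0
    simp only [lambertTerm, pow_zero, one_mul, Complex.exp_neg, Complex.exp_nat_mul,
      Complex.exp_add, hω, ← hw, mul_pow, inv_pow]
    have hu' : q ^ (a : ℕ) * ζ⁻¹ / (1 - q ^ (a : ℕ) * ζ⁻¹) =
        q ^ (a : ℕ) / (ζ - q ^ (a : ℕ)) := by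
      rw [← mul_div_mul_left _ _ hζ0]
      congr 1 <;> field_simp
    have hu2 : ζ - q ^ (a : ℕ) ≠ 0 := fun h => hu (by
      rw [← sub_eq_zero.mp h, mul_inv_cancel₀ hζ0, sub_self])
    rw [hu']
    field_simp
    ring
  have hs := ((summable_lambertTerm hT hq hζ 0 (x := x + ω) (by
    rw [Complex.add_re, hωre, abs_lt]; constructor <;> linarith)).hasSum).sub
    ((summable_lambertTerm hT hq hζ 0 (x := x) (by rw [abs_of_pos h0]; exact h1)).hasSum.mul_left ζ)
  simp only [hterm] at hs
  have hg := (hasSum_geometric_pnat hqw).neg.sub ((hasSum_geometric_pnat hw1).mul_left ζ)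
  have heq := hs.unique hg
  have hL : lambertSum q ζ 0 (x + ω) =
      ζ * lambertSum q ζ 0 x + (-(q * w / (1 - q * w)) - ζ * (w⁻¹ / (1 - w⁻¹))) := by
    rw [← heq, lambertSum, lambertSum]
    ring
  have hne1 : w - 1 ≠ 0 := fun h => by
    rw [sub_eq_zero.mp h, norm_one] at hwn
    exact lt_irrefl _ hwn
  have hne2 : 1 - q * w ≠ 0 := fun h => by
    rw [← sub_eq_zero.mp h, norm_one] at hqw
    exact lt_irrefl _ hqw
  have hne3 : 1 - ζ ≠ 0 := sub_ne_zero.mpr hζ1.symm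
  have hwinv : w⁻¹ / (1 - w⁻¹) = 1 / (w - 1) := by
    rw [← mul_div_mul_left _ _ hw0]
    congr 1 <;> field_simp
  have hqw' : 1 / (q * w - 1) = -(1 / (1 - q * w)) := by
    rw [← neg_sub, one_div, one_div, inv_neg]
  rw [kroneckerFun, kroneckerFun, hL, Complex.exp_add, hω, ← hw, hwinv, mul_comm w q, hqw']
  field_simp
  ring

theorem analyticAt_kroneckerFun {q ζ : ℂ} {T : ℝ} (hT : ‖q‖ = Real.exp (-T)) (hq : ‖q‖ < 1)
    (hζ : ‖ζ‖ = 1) {x : ℂ} (hx : |x.re| < T) (hx1 : Complex.exp x ≠ 1) :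
    AnalyticAt ℂ (kroneckerFun q ζ) x := by
  have h1 : AnalyticAt ℂ (fun y => 1 / (Complex.exp y - 1)) x :=
    analyticAt_const.div (by fun_prop) (sub_ne_zero.mpr hx1)
  exact (h1.fun_add (analyticAt_const (v := 1 / (1 - ζ)))).fun_sub
    (analyticAt_lambertSum hT hq hζ 0 hx)

/-! ### Laurent expansion of the Kronecker function at the origin -/

/-- The regularised Kronecker function `x F(x)`. The first summand is `x / (eˣ - 1)`, written so that it
takes the value `1` at the origin. -/
noncomputable def regKroneckerFun (q ζ x : ℂ) : ℂ :=
  (dslope Complex.exp 0 x)⁻¹ + x * (1 / (1 - ζ) - lambertSum q ζ 0 x)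

theorem dslope_exp_zero_self : dslope Complex.exp 0 0 = 1 := by simp

theorem analyticAt_dslope_zero {f : ℂ → ℂ} (hf : AnalyticAt ℂ f 0) :
    AnalyticAt ℂ (dslope f 0) 0 := by
  obtain ⟨p, hp⟩ := hf
  exact ⟨_, hp.has_fpower_series_dslope_fslope⟩

theorem taylorSeriesAtZero_dslope {f : ℂ → ℂ} (hf : AnalyticAt ℂ f 0) :
    PowerSeries.X * taylorSeriesAtZero (dslope f 0) =
      taylorSeriesAtZero f - PowerSeries.C (f 0) := by
  rw [← taylorSeriesAtZero.id_mul (analyticAt_dslope_zero hf),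
    ← taylorSeriesAtZero.const, ← taylorSeriesAtZero.sub hf analyticAt_const]
  congr 1
  funext x
  simpa using sub_smul_dslope f 0 x

theorem analyticAt_inv_dslope_exp : AnalyticAt ℂ (fun x => (dslope Complex.exp 0 x)⁻¹) 0 :=
  (analyticAt_dslope_zero (by fun_prop)).fun_inv (by rw [dslope_exp_zero_self]; exact one_ne_zero)

/-- The function `x / (eˣ - 1)` generates the Bernoulli numbers. -/
theorem taylorSeriesAtZero_inv_dslope_exp :
    taylorSeriesAtZero (fun x => (dslope Complex.exp 0 x)⁻¹) = bernoulliPowerSeries ℂ := by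
  have han : AnalyticAt ℂ (dslope Complex.exp 0) 0 := analyticAt_dslope_zero (by fun_prop)
  have h1 := taylorSeriesAtZero_dslope (f := Complex.exp) (by fun_prop)
  rw [taylorSeriesAtZero.exp, Complex.exp_zero, map_one] at h1
  have h2 : taylorSeriesAtZero (fun x => (dslope Complex.exp 0 x)⁻¹) *
      taylorSeriesAtZero (dslope Complex.exp 0) = 1 := by
    rw [← taylorSeriesAtZero.mul analyticAt_inv_dslope_exp han,
      ← map_one PowerSeries.C, ← taylorSeriesAtZero.const]
    refine taylorSeriesAtZero.congr ?_
    filter_upwards [han.continuousAt.eventually_ne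
      (show dslope Complex.exp 0 0 ≠ 0 by rw [dslope_exp_zero_self]; exact one_ne_zero)] with x hx
    exact inv_mul_cancel₀ hx
  have h3 := bernoulliPowerSeries_mul_exp_sub_one ℂ
  have hne : PowerSeries.exp ℂ - 1 ≠ 0 := fun h => by
    rw [h, mul_zero] at h3
    exact PowerSeries.X_ne_zero h3.symm
  refine mul_right_cancel₀ hne ?_
  rw [h3, ← h1, mul_left_comm, h2, mul_one]

theorem analyticAt_regKroneckerFun {q ζ : ℂ} {T : ℝ} (hT : ‖q‖ = Real.exp (-T)) (hq : ‖q‖ < 1)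
    (hζ : ‖ζ‖ = 1) : AnalyticAt ℂ (regKroneckerFun q ζ) 0 := by
  have hT0 : 0 < T := by
    rw [hT, Real.exp_lt_one_iff] at hq
    linarith
  have hL : AnalyticAt ℂ (lambertSum q ζ 0) 0 := analyticAt_lambertSum hT hq hζ 0 (by simpa)
  exact analyticAt_inv_dslope_exp.fun_add (analyticAt_id.fun_mul (analyticAt_const.fun_sub hL))

theorem regKroneckerFun_zero (q ζ : ℂ) : regKroneckerFun q ζ 0 = 1 := by
  rw [regKroneckerFun, dslope_exp_zero_self, inv_one, zero_mul, add_zero]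

theorem regKroneckerFun_of_ne {q ζ x : ℂ} (hx : x ≠ 0) :
    regKroneckerFun q ζ x = x * kroneckerFun q ζ x := by
  rw [regKroneckerFun, kroneckerFun, dslope_of_ne _ hx, slope_def_field, Complex.exp_zero,
    sub_zero, inv_div]
  ring

theorem coeff_succ_taylorSeriesAtZero_regKroneckerFun {q ζ : ℂ} {T : ℝ}
    (hT : ‖q‖ = Real.exp (-T)) (hq : ‖q‖ < 1) (hζ : ‖ζ‖ = 1) (j : ℕ) :
    PowerSeries.coeff (j + 1) (taylorSeriesAtZero (regKroneckerFun q ζ)) =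
      (bernoulli (j + 1) : ℂ) / ((j + 1).factorial : ℂ) + (if j = 0 then 1 / (1 - ζ) else 0) -
        lambertSum q ζ j 0 / (j.factorial : ℂ) := by
  have hT0 : 0 < T := by
    rw [hT, Real.exp_lt_one_iff] at hq
    linarith
  have h0 : |(0 : ℂ).re| < T := by simpa
  have hL : AnalyticAt ℂ (lambertSum q ζ 0) 0 := analyticAt_lambertSum hT hq hζ 0 h0
  have h1 : taylorSeriesAtZero (regKroneckerFun q ζ) = bernoulliPowerSeries ℂ +
      PowerSeries.X * (PowerSeries.C (1 / (1 - ζ)) - taylorSeriesAtZero (lambertSum q ζ 0)) := by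
    have hcL : AnalyticAt ℂ (fun x => 1 / (1 - ζ) - lambertSum q ζ 0 x) 0 :=
      analyticAt_const.fun_sub hL
    have hxcL : AnalyticAt ℂ (fun x => x * (1 / (1 - ζ) - lambertSum q ζ 0 x)) 0 :=
      analyticAt_id.fun_mul hcL
    rw [← taylorSeriesAtZero_inv_dslope_exp, ← taylorSeriesAtZero.const,
      ← taylorSeriesAtZero.sub analyticAt_const hL,
      ← taylorSeriesAtZero.id_mul hcL, ← taylorSeriesAtZero.add analyticAt_inv_dslope_exp hxcL]
    rfl
  rw [h1, map_add, PowerSeries.coeff_succ_X_mul, map_sub, PowerSeries.coeff_C]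
  simp only [bernoulliPowerSeries, taylorSeriesAtZero, PowerSeries.coeff_mk,
    iteratedDeriv_lambertSum hT hq hζ j h0]
  rw [add_sub_assoc]
  simp

/-- Near the origin the derivatives of `F` are those of `1 / x` plus those of the regular part. -/
theorem iteratedDeriv_kroneckerFun {q ζ : ℂ} {T : ℝ} (hT : ‖q‖ = Real.exp (-T)) (hq : ‖q‖ < 1)
    (hζ : ‖ζ‖ = 1) (r : ℕ) :
    ∀ᶠ x in 𝓝[≠] (0 : ℂ), iteratedDeriv r (kroneckerFun q ζ) x =
      (-1) ^ r * r.factorial * x⁻¹ ^ (r + 1) +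
        iteratedDeriv r (dslope (regKroneckerFun q ζ) 0) x := by
  have hg := analyticAt_dslope_zero (analyticAt_regKroneckerFun hT hq hζ)
  filter_upwards [hg.eventually_analyticAt.filter_mono nhdsWithin_le_nhds,
    self_mem_nhdsWithin] with x hgx hx
  have hx0 : x ≠ 0 := hx
  have h1 : kroneckerFun q ζ =ᶠ[𝓝 x] fun y => y⁻¹ + dslope (regKroneckerFun q ζ) 0 y := by
    filter_upwards [isOpen_compl_singleton.mem_nhds hx] with y hy
    have hy0 : y ≠ 0 := hy
    rw [dslope_of_ne _ hy0, slope_def_field, regKroneckerFun_zero, regKroneckerFun_of_ne hy0]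
    field_simp
    ring
  rw [h1.iteratedDeriv_eq r,
    iteratedDeriv_fun_add (analyticAt_inv hx0).contDiffAt hgx.contDiffAt]
  congr 1
  rw [iteratedDeriv_eq_iterate]
  change deriv^[r] Inv.inv x = _
  rw [iter_deriv_inv, show (-1 - (r : ℤ)) = -((r + 1 : ℕ) : ℤ) by push_cast; ring, zpow_neg,
    zpow_natCast, inv_pow]

/-! ### The relation between the Laurent coefficients -/

section LaurentCoefficients

variable {q ζ ω : ℂ} {T : ℝ}

theorem iteratedDeriv_kroneckerFun_add_two_pi_mul_I (q ζ : ℂ) (r : ℕ) (x : ℂ) :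
    iteratedDeriv r (kroneckerFun q ζ) (x + 2 * Real.pi * Complex.I) =
      iteratedDeriv r (kroneckerFun q ζ) x := by
  have h := congrFun (iteratedDeriv_comp_add_const r (kroneckerFun q ζ)
    (2 * Real.pi * Complex.I)) x
  rw [← h]
  congr 1
  funext y
  exact kroneckerFun_add_two_pi_mul_I q ζ y

theorem iteratedDeriv_kroneckerFun_add (hT : ‖q‖ = Real.exp (-T)) (hq : ‖q‖ < 1)
    (hζ : ‖ζ‖ = 1) (hζ1 : ζ ≠ 1) (hω : Complex.exp ω = q) (r : ℕ) {x : ℂ} (h0 : 0 < x.re)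
    (h1 : x.re < T) :
    iteratedDeriv r (kroneckerFun q ζ) (x + ω) = ζ * iteratedDeriv r (kroneckerFun q ζ) x := by
  have h := congrFun (iteratedDeriv_comp_add_const r (kroneckerFun q ζ) ω) x
  have h2 : (fun y => kroneckerFun q ζ (y + ω)) =ᶠ[𝓝 x] fun y => ζ * kroneckerFun q ζ y := by
    filter_upwards [(isOpen_lt continuous_const Complex.continuous_re).mem_nhds h0,
      (isOpen_lt Complex.continuous_re continuous_const).mem_nhds h1] with y hy0 hy1
    exact kroneckerFun_add hT hq hζ hζ1 hω hy0 hy1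
  rw [← h, h2.iteratedDeriv_eq r, iteratedDeriv_const_mul_field]

/-- The function `F(x)ⁿ + ∑_{l < n} p_l F⁽ʳ⁾(-x) / r!` with `r = n - l - 1`. The principal part of
`F⁽ʳ⁾(-x) / r!` at the origin is `-x^(l - n)`, so this has no pole there if `p_l` is the coefficient of
`x^(l - n)` in `F(x)ⁿ`. -/
noncomputable def kroneckerDefect (q ζ : ℂ) (n : ℕ) (p : ℕ → ℂ) (x : ℂ) : ℂ :=
  kroneckerFun q ζ x ^ n + ∑ l ∈ Finset.range n,
    p l / ((n - l - 1).factorial : ℂ) * iteratedDeriv (n - l - 1) (kroneckerFun q ζ) (-x)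

theorem kroneckerDefect_add_two_pi_mul_I (q ζ : ℂ) (n : ℕ) (p : ℕ → ℂ) (x : ℂ) :
    kroneckerDefect q ζ n p (x + 2 * Real.pi * Complex.I) = kroneckerDefect q ζ n p x := by
  simp only [kroneckerDefect, kroneckerFun_add_two_pi_mul_I]
  congr 1
  refine Finset.sum_congr rfl fun l _ => ?_
  rw [← iteratedDeriv_kroneckerFun_add_two_pi_mul_I, neg_add, neg_add_cancel_right]

theorem kroneckerDefect_add (hT : ‖q‖ = Real.exp (-T)) (hq : ‖q‖ < 1) (hζ : ‖ζ‖ = 1)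
    (hζ1 : ζ ≠ 1) (hω : Complex.exp ω = q) {n : ℕ} (hn : ζ ^ (n + 1) = 1) (p : ℕ → ℂ) {x : ℂ}
    (h0 : 0 < x.re) (h1 : x.re < T) :
    kroneckerDefect q ζ n p (x + ω) = ζ⁻¹ * kroneckerDefect q ζ n p x := by
  have hωre : ω.re = -T := by
    rw [← hω, Complex.norm_exp, Real.exp_eq_exp] at hT
    exact hT
  have hζ0 : ζ ≠ 0 := norm_ne_zero_iff.mp (by rw [hζ]; exact one_ne_zero)
  have hζn : ζ ^ n = ζ⁻¹ := eq_inv_of_mul_eq_one_left (by rw [← pow_succ, hn])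
  rw [kroneckerDefect, kroneckerDefect, kroneckerFun_add hT hq hζ hζ1 hω h0 h1, mul_pow, hζn,
    mul_add, Finset.mul_sum]
  congr 1
  refine Finset.sum_congr rfl fun l _ => ?_
  have h := iteratedDeriv_kroneckerFun_add hT hq hζ hζ1 hω (n - l - 1) (x := -(x + ω))
    (by rw [Complex.neg_re, Complex.add_re, hωre]; linarith)
    (by rw [Complex.neg_re, Complex.add_re, hωre]; linarith)
  rw [show -(x + ω) + ω = -x by ring] at h
  rw [h]
  field_simp

/-- The product `xⁿ D(x)` for the defect `D`, as a function that is visibly analytic at `0`. -/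
noncomputable def regKroneckerDefect (q ζ : ℂ) (n : ℕ) (p : ℕ → ℂ) (x : ℂ) : ℂ :=
  regKroneckerFun q ζ x ^ n + ∑ l ∈ Finset.range n, p l * (x ^ n *
    (((n - l - 1).factorial : ℂ)⁻¹ *
      iteratedDeriv (n - l - 1) (dslope (regKroneckerFun q ζ) 0) (-x)) - x ^ l)

theorem regKroneckerDefect_eventuallyEq (hT : ‖q‖ = Real.exp (-T)) (hq : ‖q‖ < 1)
    (hζ : ‖ζ‖ = 1) (n : ℕ) (p : ℕ → ℂ) :
    ∀ᶠ x in 𝓝[≠] 0, regKroneckerDefect q ζ n p x = x ^ n * kroneckerDefect q ζ n p x := by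
  have hneg : Tendsto (fun x : ℂ => -x) (𝓝[≠] 0) (𝓝[≠] 0) := by
    refine tendsto_nhdsWithin_iff.mpr ⟨?_, ?_⟩
    · have : Tendsto (fun x : ℂ => -x) (𝓝 0) (𝓝 (-0)) := continuous_neg.tendsto 0
      rw [neg_zero] at this
      exact this.mono_left nhdsWithin_le_nhds
    · filter_upwards [self_mem_nhdsWithin] with x hx h
      exact hx (neg_eq_zero.mp h)
  have hall : ∀ᶠ x in 𝓝[≠] (0 : ℂ), ∀ l ∈ Finset.range n, _ :=
    (Finset.eventually_all (Finset.range n)).mpr fun l _ =>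
      hneg.eventually (iteratedDeriv_kroneckerFun hT hq hζ (n - l - 1))
  filter_upwards [hall, self_mem_nhdsWithin] with x hx hx0
  have hx0' : x ≠ 0 := hx0
  rw [regKroneckerDefect, kroneckerDefect, mul_add, regKroneckerFun_of_ne hx0', mul_pow,
    Finset.mul_sum]
  congr 1
  refine Finset.sum_congr rfl fun l hl => ?_
  rw [hx l hl]
  obtain ⟨r, rfl⟩ : ∃ r, n = l + r + 1 := ⟨n - l - 1, by have := Finset.mem_range.mp hl; omega⟩
  have hr : l + r + 1 - l - 1 = r := by omega
  rw [hr]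
  have hr0 : (r.factorial : ℂ) ≠ 0 := by exact_mod_cast r.factorial_ne_zero
  have hs : (-1 : ℂ) ^ r * (-x)⁻¹ ^ (r + 1) = -(x⁻¹ ^ (r + 1)) := by
    rw [inv_neg, neg_pow x⁻¹, ← mul_assoc, ← pow_add, show r + (r + 1) = 2 * r + 1 by ring,
      pow_succ, pow_mul]
    simp
  have hxx : x ^ (l + r + 1) * x⁻¹ ^ (r + 1) = x ^ l := by
    rw [add_assoc, pow_add, mul_assoc, ← mul_pow, mul_inv_cancel₀ hx0', one_pow, mul_one]
  rw [mul_right_comm, hs]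
  rw [← hxx]
  field_simp
  ring

theorem analyticAt_iteratedDeriv_dslope_neg (hT : ‖q‖ = Real.exp (-T)) (hq : ‖q‖ < 1)
    (hζ : ‖ζ‖ = 1) (r : ℕ) :
    AnalyticAt ℂ (fun x => iteratedDeriv r (dslope (regKroneckerFun q ζ) 0) (-x)) 0 := by
  have hg := analyticAt_dslope_zero (analyticAt_regKroneckerFun hT hq hζ)
  have h1 : AnalyticAt ℂ (iteratedDeriv r (dslope (regKroneckerFun q ζ) 0)) (-0) := by
    rw [iteratedDeriv_eq_iterate, neg_zero]
    exact hg.iterated_deriv r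
  exact h1.comp analyticAt_id.fun_neg

theorem analyticAt_regKroneckerDefect_summand (hT : ‖q‖ = Real.exp (-T)) (hq : ‖q‖ < 1)
    (hζ : ‖ζ‖ = 1) (n l : ℕ) (c : ℂ) (r : ℕ) (b : ℂ) :
    AnalyticAt ℂ (fun x => c * (x ^ n *
      (b * iteratedDeriv r (dslope (regKroneckerFun q ζ) 0) (-x)) - x ^ l)) 0 :=
  analyticAt_const.fun_mul (((analyticAt_id.fun_pow n).fun_mul (analyticAt_const.fun_mul
    (analyticAt_iteratedDeriv_dslope_neg hT hq hζ r))).fun_sub (analyticAt_id.fun_pow l))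

theorem analyticAt_regKroneckerDefect (hT : ‖q‖ = Real.exp (-T)) (hq : ‖q‖ < 1)
    (hζ : ‖ζ‖ = 1) (n : ℕ) (p : ℕ → ℂ) : AnalyticAt ℂ (regKroneckerDefect q ζ n p) 0 :=
  ((analyticAt_regKroneckerFun hT hq hζ).fun_pow n).fun_add
    (Finset.analyticAt_fun_sum _ fun _ _ =>
      analyticAt_regKroneckerDefect_summand hT hq hζ _ _ _ _ _)

theorem coeff_taylorSeriesAtZero_regKroneckerDefect (hT : ‖q‖ = Real.exp (-T)) (hq : ‖q‖ < 1)
    (hζ : ‖ζ‖ = 1) (n : ℕ) (p : ℕ → ℂ) (s : ℕ) :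
    PowerSeries.coeff s (taylorSeriesAtZero (regKroneckerDefect q ζ n p)) =
      PowerSeries.coeff s (taylorSeriesAtZero (regKroneckerFun q ζ) ^ n) +
      ∑ l ∈ Finset.range n, p l * ((if n ≤ s then (-1) ^ (s - n) *
        ((s - n + (n - l - 1)).choose (n - l - 1) : ℂ) * PowerSeries.coeff (s - n + (n - l - 1) + 1)
          (taylorSeriesAtZero (regKroneckerFun q ζ)) else 0) - if s = l then 1 else 0) := by
  have hh := analyticAt_regKroneckerFun hT hq hζ
  have hX := taylorSeriesAtZero_dslope hh
  have hg : ∀ t, PowerSeries.coeff t (taylorSeriesAtZero (dslope (regKroneckerFun q ζ) 0)) =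
      PowerSeries.coeff (t + 1) (taylorSeriesAtZero (regKroneckerFun q ζ)) := fun t => by
    rw [← PowerSeries.coeff_succ_X_mul, hX, map_sub, PowerSeries.coeff_C]
    simp
  have hexp : taylorSeriesAtZero (regKroneckerDefect q ζ n p) =
      taylorSeriesAtZero (regKroneckerFun q ζ) ^ n + ∑ l ∈ Finset.range n, PowerSeries.C (p l) *
        (PowerSeries.X ^ n * (PowerSeries.C ((n - l - 1).factorial : ℂ)⁻¹ * taylorSeriesAtZero
          (fun x => iteratedDeriv (n - l - 1) (dslope (regKroneckerFun q ζ) 0) (-x))) -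
          PowerSeries.X ^ l) := by
    have h1 := taylorSeriesAtZero.add (hh.fun_pow n) (Finset.analyticAt_fun_sum (Finset.range n)
      fun l _ => analyticAt_regKroneckerDefect_summand hT hq hζ n l (p l) (n - l - 1)
        ((n - l - 1).factorial : ℂ)⁻¹)
    refine h1.trans ?_
    rw [taylorSeriesAtZero.pow hh, taylorSeriesAtZero.sum _ fun l _ =>
      analyticAt_regKroneckerDefect_summand hT hq hζ n l (p l) (n - l - 1)
        ((n - l - 1).factorial : ℂ)⁻¹]
    congr 1
    refine Finset.sum_congr rfl fun l _ => ?_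
    have hd := analyticAt_iteratedDeriv_dslope_neg hT hq hζ (n - l - 1)
    have hcd := (analyticAt_const (v := ((n - l - 1).factorial : ℂ)⁻¹)).fun_mul hd
    have hn : AnalyticAt ℂ (fun x : ℂ => x ^ n) 0 := analyticAt_id.fun_pow n
    have hl : AnalyticAt ℂ (fun x : ℂ => x ^ l) 0 := analyticAt_id.fun_pow l
    rw [taylorSeriesAtZero.mul analyticAt_const ((hn.fun_mul hcd).fun_sub hl),
      taylorSeriesAtZero.const, taylorSeriesAtZero.sub (hn.fun_mul hcd) hl,
      taylorSeriesAtZero.mul hn hcd, taylorSeriesAtZero.mul analyticAt_const hd,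
      taylorSeriesAtZero.const, taylorSeriesAtZero.pow_id, taylorSeriesAtZero.pow_id]
  rw [hexp, map_add, map_sum]
  congr 1
  refine Finset.sum_congr rfl fun l _ => ?_
  rw [PowerSeries.coeff_C_mul, map_sub, PowerSeries.coeff_X_pow_mul', PowerSeries.coeff_X_pow]
  congr 3
  rw [PowerSeries.coeff_C_mul, taylorSeriesAtZero.coeff_iteratedDeriv_comp_neg, hg]
  have hr0 : ((n - l - 1).factorial : ℂ) ≠ 0 := by exact_mod_cast (n - l - 1).factorial_ne_zero
  field_simp

/-- If `ζ ^ (n + 1) = 1` then the defect vanishes, because it is holomorphic and quasi-periodic. On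
the level of Laurent coefficients this is a relation between the coefficients of `F` and `Fⁿ`. -/
theorem coeff_pow_taylorSeriesAtZero_regKroneckerFun (hT : ‖q‖ = Real.exp (-T)) (hq : ‖q‖ < 1)
    (hζ : ‖ζ‖ = 1) (hζ1 : ζ ≠ 1) (hω : Complex.exp ω = q) {n : ℕ} (hn : ζ ^ (n + 1) = 1) {k : ℕ}
    (hk : n ≤ k) :
    PowerSeries.coeff k (taylorSeriesAtZero (regKroneckerFun q ζ) ^ n) +
      (-1) ^ (k - n) * ∑ l ∈ Finset.range n, ((k - l - 1).choose (n - l - 1) : ℂ) *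
        PowerSeries.coeff (k - l) (taylorSeriesAtZero (regKroneckerFun q ζ)) *
        PowerSeries.coeff l (taylorSeriesAtZero (regKroneckerFun q ζ) ^ n) = 0 := by
  set Φ := taylorSeriesAtZero (regKroneckerFun q ζ) with hΦ
  set p : ℕ → ℂ := fun l => PowerSeries.coeff l (Φ ^ n) with hp
  have hT0 : 0 < T := by
    rw [hT, Real.exp_lt_one_iff] at hq
    linarith
  have hωre : ω.re = -T := by
    rw [← hω, Complex.norm_exp, Real.exp_eq_exp] at hT
    exact hT
  have hcoeff := coeff_taylorSeriesAtZero_regKroneckerDefect hT hq hζ n p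
  -- The choice of the weights `p` cancels the principal part at the origin.
  have hlow : ∀ s < n,
      PowerSeries.coeff s (taylorSeriesAtZero (regKroneckerDefect q ζ n p)) = 0 := fun s hs => by
    rw [hcoeff, ← hΦ]
    simp [Nat.not_le.mpr hs, hs, hp]
  obtain ⟨f, hf, hfeq⟩ :=
    taylorSeriesAtZero.exists_eq_pow_mul (analyticAt_regKroneckerDefect hT hq hζ n p) hlow
  have hreg := regKroneckerDefect_eventuallyEq hT hq hζ n p
  have hDf : kroneckerDefect q ζ n p =ᶠ[𝓝[≠] 0] f := by
    filter_upwards [hreg, hfeq.filter_mono nhdsWithin_le_nhds, self_mem_nhdsWithin] with x h1 h2 h3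
    exact mul_left_cancel₀ (pow_ne_zero n (show x ≠ 0 from h3)) (h1.symm.trans h2)
  have hzero : ∀ᶠ x in 𝓝[≠] (0 : ℂ), kroneckerDefect q ζ n p x = 0 := by
    refine eventually_eq_zero_of_quasiPeriodic (c := ζ⁻¹) hT0 hωre (by rw [norm_inv, hζ, inv_one])
      (inv_ne_one.mpr hζ1) (fun x hx => ?_) (kroneckerDefect_add_two_pi_mul_I q ζ n p)
      (fun x h0 h1 => kroneckerDefect_add hT hq hζ hζ1 hω hn p h0 h1) (x := 0) (by simpa)
    -- The singularities in the strip are the points of `2πiℤ`, all translates of the origin.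
    by_cases hx1 : Complex.exp x = 1
    · obtain ⟨m, hm⟩ := Complex.exp_eq_one_iff.mp hx1
      have hper : ∀ y, kroneckerDefect q ζ n p (y - x) = kroneckerDefect q ζ n p y := fun y => by
        have h : Function.Periodic (kroneckerDefect q ζ n p) (2 * Real.pi * Complex.I) :=
          kroneckerDefect_add_two_pi_mul_I q ζ n p
        rw [hm]
        exact h.sub_int_mul_eq m
      refine ⟨fun y => f (y - x), ?_, ?_⟩
      · have hf' : AnalyticAt ℂ f (x - x) := by rwa [sub_self]
        exact hf'.comp (f := fun y => y - x) (analyticAt_id.fun_sub analyticAt_const)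
      · have ht : Tendsto (fun y => y - x) (𝓝[≠] x) (𝓝[≠] 0) := by
          refine tendsto_nhdsWithin_iff.mpr ⟨?_, ?_⟩
          · have : Tendsto (fun y => y - x) (𝓝 x) (𝓝 (x - x)) :=
              (continuous_id.sub continuous_const).tendsto x
            rw [sub_self] at this
            exact this.mono_left nhdsWithin_le_nhds
          · filter_upwards [self_mem_nhdsWithin] with y hy h
            exact hy (sub_eq_zero.mp h)
        filter_upwards [ht.eventually hDf] with y hy
        rw [← hper y, hy]
    · refine ⟨_, ?_, EventuallyEq.rfl⟩
      refine ((analyticAt_kroneckerFun hT hq hζ hx hx1).fun_pow n).fun_add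
        (Finset.analyticAt_fun_sum _ fun l _ => analyticAt_const.fun_mul ?_)
      have hF : AnalyticAt ℂ (iteratedDeriv (n - l - 1) (kroneckerFun q ζ)) (-x) := by
        rw [iteratedDeriv_eq_iterate]
        have hx' : |(-x).re| < T := by rwa [Complex.neg_re, abs_neg]
        refine (analyticAt_kroneckerFun hT hq hζ hx' ?_).iterated_deriv _
        rwa [Complex.exp_neg, Ne, inv_eq_one]
      exact hF.comp analyticAt_id.fun_neg
  have hE : regKroneckerDefect q ζ n p =ᶠ[𝓝 0] fun _ => 0 := by
    refine ((analyticAt_regKroneckerDefect hT hq hζ n p).frequently_eq_iff_eventually_eq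
      analyticAt_const).mp (Eventually.frequently ?_)
    filter_upwards [hreg, hzero] with x h1 h2
    rw [h1, h2, mul_zero]
  have hk0 := hcoeff k
  rw [taylorSeriesAtZero.congr hE, taylorSeriesAtZero.const, map_zero, map_zero, ← hΦ] at hk0
  rw [hk0, Finset.mul_sum]
  congr 1
  refine Finset.sum_congr rfl fun l hl => ?_
  have hl' := Finset.mem_range.mp hl
  rw [if_pos hk, if_neg (by omega), show k - n + (n - l - 1) = k - l - 1 by omega,
    show k - l - 1 + 1 = k - l by omega]
  ring

end LaurentCoefficients

/-! ### Eisenstein series as Laurent coefficients -/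

theorem coeff_pow_eq_sum_piAntidiag {R : Type*} [CommRing R] (φ : PowerSeries R) (n s : ℕ) :
    PowerSeries.coeff s (φ ^ n) = ∑ j ∈ Finset.piAntidiag (Finset.univ : Finset (Fin n)) s,
      ∏ i, PowerSeries.coeff (j i) φ := by
  have h : φ ^ n = ∏ _i : Fin n, φ := by simp
  rw [h, PowerSeries.coeff_prod]
  refine Finset.sum_equiv Finsupp.equivFunOnFinite (fun l => ?_) fun l _ => rfl
  simp [Finset.mem_finsuppAntidiag]

theorem coeff_taylorSeriesAtZero_regKroneckerFun_eq_eisensteinG {N : ℕ} (hN : 2 ≤ N)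
    (τ : UpperHalfPlane) (j : ℕ) :
    PowerSeries.coeff j (taylorSeriesAtZero (regKroneckerFun
      (Complex.exp (2 * Real.pi * Complex.I * τ)) (Complex.exp (2 * Real.pi * Complex.I / N)))) =
      eisensteinG j N τ := by
  set q := Complex.exp (2 * Real.pi * Complex.I * τ) with hq
  set ζ := Complex.exp (2 * Real.pi * Complex.I / N) with hζ
  have hζ1 : ζ ≠ 1 := (Complex.isPrimitiveRoot_exp N (by omega)).ne_one hN
  have hζn : ‖ζ‖ = 1 := (Complex.isPrimitiveRoot_exp N (by omega)).norm'_eq_one (by omega)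
  have hqn : ‖q‖ < 1 := UpperHalfPlane.norm_exp_two_pi_I_lt_one τ
  rcases j with _ | j
  · simp [taylorSeriesAtZero, regKroneckerFun_zero, eisensteinG]
  · rw [coeff_succ_taylorSeriesAtZero_regKroneckerFun (T := -(2 * Real.pi * Complex.I * τ).re)
      (by rw [hq, Complex.norm_exp, neg_neg]) hqn hζn, lambertSum_zero_eq hqn hζn, eisensteinG,
      if_neg (Nat.succ_ne_zero j), sub_eq_add_neg, add_comm, ← tsum_div_const]
    congr 2
    · refine tsum_congr fun m => ?_
      rw [eisensteinCoeff, Nat.add_sub_cancel, ← hζ, mul_right_comm _ Complex.I,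
        show 2 * (Real.pi : ℂ) * ((m : ℕ) : ℂ) * Complex.I * (τ : ℂ) =
          ((m : ℕ) : ℂ) * (2 * Real.pi * Complex.I * τ) by ring, Complex.exp_nat_mul, ← hq,
        mul_div_right_comm, Finset.sum_div]
      congr 1
      exact Finset.sum_congr rfl fun d _ => by rw [mul_div_assoc]
    · rw [eisensteinConst, ← hζ]
      rcases j with _ | j
      · -- `B₁ + 1 / (1 - ζ) = (1 + ζ) / (2 (1 - ζ))` since `B₁ = -1 / 2`.
        have h1 : 1 - ζ ≠ 0 := sub_ne_zero.mpr hζ1.symm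
        simp only [zero_add, if_true, bernoulli_one, Nat.factorial_one]
        push_cast
        field_simp
        ring
      · rw [if_neg (by omega), if_neg (by omega), add_zero]

theorem proposition4p3 (n N k : ℕ) (hN : 2 ≤ N) (hdvd : N ∣ n + 1) (hk : n ≤ k)
    (τ : UpperHalfPlane) :
    (-1 : ℂ) ^ (n + k + 1) * eisensteinProdSum n k N τ =
      ∑ l ∈ Finset.range n, ((k - l - 1).choose (n - l - 1) : ℂ) *
        eisensteinG (k - l) N τ * eisensteinProdSum n l N τ := by
  have hprim := Complex.isPrimitiveRoot_exp N (by omega)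
  have h := coeff_pow_taylorSeriesAtZero_regKroneckerFun
    (q := Complex.exp (2 * Real.pi * Complex.I * τ)) (T := -(2 * Real.pi * Complex.I * τ).re)
    (by rw [Complex.norm_exp, neg_neg]) (UpperHalfPlane.norm_exp_two_pi_I_lt_one τ)
    (hprim.norm'_eq_one (by omega)) (hprim.ne_one hN) rfl ((hprim.pow_eq_one_iff_dvd _).mpr hdvd) hk
  simp only [coeff_pow_eq_sum_piAntidiag,
    coeff_taylorSeriesAtZero_regKroneckerFun_eq_eisensteinG hN] at h
  change eisensteinProdSum n k N τ + (-1) ^ (k - n) * ∑ l ∈ Finset.range n,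
    ((k - l - 1).choose (n - l - 1) : ℂ) * eisensteinG (k - l) N τ *
      eisensteinProdSum n l N τ = 0 at h
  obtain ⟨r, rfl⟩ := Nat.exists_eq_add_of_le hk
  rw [Nat.add_sub_cancel_left] at h
  have hs : (-1 : ℂ) ^ (n + (n + r) + 1) = -(-1) ^ r := by
    rw [show n + (n + r) + 1 = 2 * n + r + 1 by ring, pow_succ, pow_add, pow_mul]
    simp
  have hrr : (-1 : ℂ) ^ r * (-1) ^ r = 1 := by rw [← mul_pow]; simp
  rw [hs, eq_neg_of_add_eq_zero_left h, neg_mul_neg, ← mul_assoc, hrr, one_mul]
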